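/- Let $\Gamma=(\mathsf V,\mathsf E)$ be a finite simplicial graph with at least one vertex, and let $G_\Gamma$ be the associated right-angled Artin group, generated by the vertices $v\in\mathsf V$ with one defining relation $vw=wv$ for each edge $\{v,w\}\in\mathsf E$. Identify the character group $\operatorname{Hom}(G_\Gamma,\mathbb C^*)$ with the torus $(\mathbb C^*)^{\mathsf V}$ by sending a character $\rho$ to $(\rho(v))_{v\in\mathsf V}$. Let $$\mathcal V_1(G_\Gamma)=\{\rho\in\operatorname{Hom}(G_\Gamma,\mathbb C^*)\mid \dim_{\mathbb C}H^1(G_\Gamma,{}_\rho\mathbb C)\ge 1\}$$ be the (first) characteristic variety, where ${}_\rho\mathbb C$ is $\mathbb C$ with $G_\Gamma$ acting through $\rho$. For $\mathsf W\subseteq\mathsf V$ let $\Gamma(\mathsf W)$ be the full subgraph of $\Gamma$ on the vertex set $\mathsf W$, and let $$\mathbb T_{\mathsf W}=\{(t_v)_{v\in\mathsf V}\in(\mathbb C^*)^{\mathsf V}\mid t_v=1\text{ for all }v\notin\mathsf W\}.$$ Call $\Gamma(\mathsf W)$ maximally disconnected if it is disconnected and $\mathsf W$ is maximal, with respect to inclusion,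 among the subsets of $\mathsf V$ with this property; here the empty graph counts as disconnected (so that for a complete graph $\Gamma$ the only such subset is $\mathsf W=\emptyset$, with $\mathbb T_\emptyset=\{1\}$, while for a non-complete $\Gamma$ all such $\mathsf W$ are non-empty). Then $$\mathcal V_1(G_\Gamma)=\bigcup_{\mathsf W}\mathbb T_{\mathsf W},$$ where the union is over all subsets $\mathsf W\subseteq\mathsf V$ such that $\Gamma(\mathsf W)$ is maximally disconnected. Moreover, this is the decomposition of $\mathcal V_1(G_\Gamma)$ into irreducible components for the Zariski topology of $(\mathbb C^*)^{\mathsf V}$: the tori $\mathbb T_{\mathsf W}$ in the union are pairwise distinct and are exactly the irreducible components of $\mathcal V_1(G_\Gamma)$. -/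

import Mathlib

noncomputable section

/-- The one-dimensional complex representation `g ↦ (z ↦ χ g * z)` of a group `G`
attached to a character `χ : G → ℂˣ`. -/
def characterRepresentation {G : Type} [Group G] (χ : G →* ℂˣ) : Representation ℂ G ℂ where
  toFun g := LinearMap.mulLeft ℂ (χ g : ℂ)
  map_one' := by ext; simp
  map_mul' g h := by ext; simp

/-- The characteristic variety `𝓥ⁱₖ(G)`: the set of characters `χ` of `G` such that the
cohomology group `Hⁱ(G, ℂ_χ)` has complex dimension at least `k`. -/
def characteristicVariety (G : Type) [Group G] (i k : ℕ) : Set (G →* ℂˣ) :=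
  {χ | (k : Cardinal) ≤ Module.rank ℂ (groupCohomology (Rep.of (characterRepresentation χ)) i)}

/-- The defining relators of the right-angled Artin group of `Γ`: the commutators
`v w v⁻¹ w⁻¹`, one for each edge `{v, w}` (in either order). -/
def raagRelators {V : Type} (Γ : SimpleGraph V) : Set (FreeGroup V) :=
  {r | ∃ v w : V, Γ.Adj v w ∧
    r = FreeGroup.of v * FreeGroup.of w * (FreeGroup.of v)⁻¹ * (FreeGroup.of w)⁻¹}

/-- The right-angled Artin group `G_Γ`, generated by the vertices of `Γ`, with a relation
`v w = w v` for each edge `{v, w}`. -/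
abbrev RightAngledArtinGroup {V : Type} (Γ : SimpleGraph V) : Type :=
  PresentedGroup (raagRelators Γ)

/-- The identification `Hom(G_Γ, ℂˣ) = (ℂˣ)^V`, `χ ↦ (χ v)_v`. -/
def raagCharacterEquiv {V : Type} (Γ : SimpleGraph V) :
    (RightAngledArtinGroup Γ →* ℂˣ) ≃* (V → ℂˣ) where
  toFun χ v := χ (PresentedGroup.of v)
  invFun t := PresentedGroup.toGroup (f := t) (by
    rintro r ⟨v, w, -, rfl⟩
    simp)
  left_inv χ := by
    ext v
    simp
  right_inv t := by
    funext v
    simp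
  map_mul' χ ψ := rfl

/-- The subset `{t | t_v = 1 for v ∉ W}` of `(ℂˣ)^V`. -/
def coordinateSubtorus {V : Type} (W : Set V) : Set (V → ℂˣ) :=
  {t | ∀ v, v ∉ W → t v = 1}

/-- The zero locus in the torus `(ℂˣ)^V` of a set of complex polynomials. -/
def torusZeroLocus {V : Type} (F : Set (MvPolynomial V ℂ)) : Set (V → ℂˣ) :=
  {t | ∀ f ∈ F, MvPolynomial.eval (fun v => (t v : ℂ)) f = 0}

/-- The Zariski topology on `(ℂˣ)^V`. Polynomials and Laurent polynomials have the same zero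
loci in the torus. -/
@[reducible] def torusZariskiTopology (V : Type) : TopologicalSpace (V → ℂˣ) :=
  TopologicalSpace.ofClosed (Set.range torusZeroLocus)
    ⟨{1}, by ext t; simp [torusZeroLocus]⟩
    (by
      intro A hA
      refine ⟨⋃₀ {F | torusZeroLocus F ∈ A}, ?_⟩
      ext t
      simp only [torusZeroLocus, Set.mem_sUnion, Set.mem_ofPred_eq, Set.mem_sInter]
      constructor
      · intro h S hS
        obtain ⟨F, rfl⟩ := hA hS
        exact fun f hf => h f ⟨F, hS, hf⟩
      · rintro h f ⟨F, hF, hf⟩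
        exact h _ hF f hf)
    (by
      rintro _ ⟨F, rfl⟩ _ ⟨F', rfl⟩
      refine ⟨{p | ∃ f ∈ F, ∃ f' ∈ F', p = f * f'}, ?_⟩
      ext t
      simp only [torusZeroLocus, Set.mem_union, Set.mem_ofPred_eq]
      constructor
      · intro h
        by_contra! hc
        obtain ⟨⟨f, hf, hft⟩, f', hf', hft'⟩ := hc
        have := h _ ⟨f, hf, f', hf', rfl⟩
        rw [map_mul] at this
        exact (mul_ne_zero hft hft') this
      · rintro (h | h) _ ⟨f, hf, f', hf', rfl⟩
        · rw [map_mul, h f hf, zero_mul]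
        · rw [map_mul, h f' hf', mul_zero])

/-- The irreducible components of a subset `S` of `(ℂˣ)^V`: the maximal elements, for
inclusion, among the subsets of `S` that are irreducible in the Zariski topology. -/
def torusIrreducibleComponents {V : Type} (S : Set (V → ℂˣ)) : Set (Set (V → ℂˣ)) :=
  {Z | Maximal (fun Y => Y ⊆ S ∧ @IsIrreducible (V → ℂˣ) (torusZariskiTopology V) Y) Z}

/-- The full subgraph `Γ(W)` is disconnected, and `W` is maximal, for inclusion, with respect
to this property. Connected graphs are nonempty, so the empty subgraph counts as
disconnected; it is maximal only if `Γ` is complete. -/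
def IsMaximallyDisconnected {V : Type} (Γ : SimpleGraph V) (W : Set V) : Prop :=
  Maximal (fun U : Set V => ¬ (Γ.induce U).Connected) W

end

/-!
A class in `H¹(G, ℂ_χ)` is represented by a crossed homomorphism `z : G → ℂ`, that is,
`z (g h) = χ g * z h + z g`, and it vanishes when `z` is principal, `z g = χ g * c - c`. For
`G = G_Γ` both notions can be read off on the generators: `z` amounts to a function `f` on the
vertices such that `f v + t v * f w = f w + t w * f v` for each edge `{v, w}`, where `t v = χ v`
(`RAAG.exists_isCrossedHom_extending`; the extension to the group is obtained by letting the vertex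
`v` act on the affine line by `x ↦ t v * x + f v`), and `z` is principal exactly when
`f v = t v * c - c` for some constant `c` and all `v`.

Let `S` be the set of vertices with `t v ≠ 1`. Along an edge starting in `S`, the edge relation
propagates the equation `f v = t v * c - c`, so every `f` is principal if `Γ(W)` is connected for
all `W ⊇ S`. If some `Γ(W)` with `W ⊇ S` is disconnected, there is a nonprincipal `f`: the
constant `1` if `S` is empty, and otherwise either `t v - 1` on one component of `Γ(W)` and `0`
elsewhere, or the indicator function of a single vertex. Thus (`RAAG.exists_nonprincipal_iff`)
`𝓥₁` is the union of the subtori `𝕋_W` with `Γ(W)` disconnected, and maximal `W` suffice as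
`𝖵` is finite.

Each `𝕋_W` is Zariski closed, and it is irreducible since substituting `1` for the variables outside
`W` turns two polynomials not vanishing on `𝕋_W` into two nonzero polynomials, whose product does
not vanish identically on the torus. As `𝕋_W ⊆ 𝕋_W'` only if `W ⊆ W'`, the union over the maximal
`W` is a finite irredundant union of closed irreducible sets, hence the decomposition into
irreducible components.
-/

/-! ### First cohomology and crossed homomorphisms -/

/-- `z` is a crossed homomorphism (1-cocycle) with values in `ℂ_χ`. -/
def IsCrossedHom {G : Type} [Group G] (χ : G →* ℂˣ) (z : G → ℂ) : Prop :=
  ∀ g h, z (g * h) = χ g * z h + z g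

theorem mem_characteristicVariety_one_one_iff {G : Type} [Group G] (χ : G →* ℂˣ) :
    χ ∈ characteristicVariety G 1 1 ↔
      ∃ z : G → ℂ, IsCrossedHom χ z ∧ ¬ ∃ c : ℂ, ∀ g, z g = χ g * c - c := by
  have hcob (z : G → ℂ) :
      z ∈ groupCohomology.coboundaries₁ (Rep.of (characterRepresentation χ)) ↔
        ∃ c : ℂ, ∀ g, z g = χ g * c - c := by
    constructor
    · rintro ⟨c, rfl⟩
      exact ⟨c, fun g => rfl⟩
    · rintro ⟨c, h⟩
      exact ⟨c, funext fun g => (h g).symm⟩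
  have hcoc (z : G → ℂ) :
      z ∈ groupCohomology.cocycles₁ (Rep.of (characterRepresentation χ)) ↔ IsCrossedHom χ z :=
    groupCohomology.mem_cocycles₁_iff (A := Rep.of (characterRepresentation χ)) z
  rw [characteristicVariety, Set.mem_ofPred_eq, Nat.cast_one, Cardinal.one_le_iff_pos,
    rank_pos_iff_nontrivial, nontrivial_iff_exists_ne 0]
  constructor
  · rintro ⟨x, hx⟩
    induction x using groupCohomology.H1_induction_on with
    | h z =>
      refine ⟨z, (hcoc _).1 z.2, fun hz => hx ?_⟩
      exact (groupCohomology.H1π_eq_zero_iff z).2 ((hcob _).2 hz)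
  · rintro ⟨z, hz, hn⟩
    refine ⟨groupCohomology.H1π _ ⟨z, (hcoc z).2 hz⟩, fun h0 => hn ?_⟩
    exact (hcob _).1 ((groupCohomology.H1π_eq_zero_iff _).1 h0)

theorem IsCrossedHom.map_one {G : Type} [Group G] {χ : G →* ℂˣ} {z : G → ℂ}
    (hz : IsCrossedHom χ z) : z 1 = 0 := by
  simpa using hz 1 1

/-! ### Crossed homomorphisms on a right-angled Artin group -/

namespace RAAG

variable {V : Type} {Γ : SimpleGraph V}

/-- The relation on a function `f` on the vertices that characterizes the restrictions to the
generators of the crossed homomorphisms for the character `t`. -/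
def IsVertexCocycle (Γ : SimpleGraph V) (t : V → ℂˣ) (f : V → ℂ) : Prop :=
  ∀ v w, Γ.Adj v w → f v + t v * f w = f w + t w * f v

/-- The restriction to the generators of a principal crossed homomorphism. -/
def IsVertexPrincipal (t : V → ℂˣ) (f : V → ℂ) : Prop :=
  ∃ c : ℂ, ∀ v, f v = t v * c - c

theorem of_mul_of_comm {v w : V} (h : Γ.Adj v w) :
    (PresentedGroup.of v * PresentedGroup.of w : RightAngledArtinGroup Γ) =
      PresentedGroup.of w * PresentedGroup.of v := by
  have h1 : (PresentedGroup.of v * PresentedGroup.of w * (PresentedGroup.of v)⁻¹ *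
      (PresentedGroup.of w)⁻¹ : RightAngledArtinGroup Γ) = 1 :=
    PresentedGroup.one_of_mem (rels := raagRelators Γ) ⟨v, w, h, rfl⟩
  rwa [mul_inv_eq_one, mul_inv_eq_iff_eq_mul] at h1

theorem isVertexCocycle_of_isCrossedHom {χ : RightAngledArtinGroup Γ →* ℂˣ}
    {z : RightAngledArtinGroup Γ → ℂ} (hz : IsCrossedHom χ z) :
    IsVertexCocycle Γ (raagCharacterEquiv Γ χ) fun v => z (PresentedGroup.of v) := by
  intro v w h
  have h1 := hz (PresentedGroup.of v) (PresentedGroup.of w)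
  rw [of_mul_of_comm h, hz] at h1
  change _ + (χ (PresentedGroup.of v) : ℂ) * _ = _ + (χ (PresentedGroup.of w) : ℂ) * _
  linear_combination -h1

/-- A crossed homomorphism is principal as soon as it is so on the generators. -/
theorem principal_of_isVertexPrincipal {χ : RightAngledArtinGroup Γ →* ℂˣ}
    {z : RightAngledArtinGroup Γ → ℂ} (hz : IsCrossedHom χ z)
    (h : IsVertexPrincipal (raagCharacterEquiv Γ χ) fun v => z (PresentedGroup.of v)) :
    ∃ c : ℂ, ∀ g, z g = χ g * c - c := by
  obtain ⟨c, hc⟩ := h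
  let H : Subgroup (RightAngledArtinGroup Γ) :=
    { carrier := {g | z g = χ g * c - c}
      one_mem' := by simp [hz.map_one]
      mul_mem' := by
        intro a b (ha : z a = _) (hb : z b = _)
        change z (a * b) = _
        rw [hz, ha, hb, map_mul, Units.val_mul]
        ring
      inv_mem' := by
        intro a (ha : z a = _)
        change z a⁻¹ = _
        have h1 := hz a a⁻¹
        have h2 : (χ a : ℂ) * χ a⁻¹ = 1 := by simp
        rw [mul_inv_cancel, hz.map_one, ha] at h1
        apply mul_left_cancel₀ (χ a).ne_zero
        linear_combination -h1 - c * h2 }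
  exact ⟨c, fun g => PresentedGroup.generated_by _ H hc g⟩

/-- The permutation `x ↦ u * x + b` of `ℂ`. -/
def affinePerm (u : ℂˣ) (b : ℂ) : Equiv.Perm ℂ :=
  u.mulLeft.trans (Equiv.addRight b)

theorem affinePerm_apply (u : ℂˣ) (b x : ℂ) : affinePerm u b x = u * x + b := rfl

/-- The translation parts of the action of the group on the affine line in which the vertex `v`
acts by `x ↦ t v * x + f v` form a crossed homomorphism extending `f`. -/
theorem exists_isCrossedHom_extending (χ : RightAngledArtinGroup Γ →* ℂˣ) {f : V → ℂ}
    (hf : IsVertexCocycle Γ (raagCharacterEquiv Γ χ) f) :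
    ∃ z, IsCrossedHom χ z ∧ ∀ v, z (PresentedGroup.of v) = f v := by
  let p : V → Equiv.Perm ℂ := fun v => affinePerm (raagCharacterEquiv Γ χ v) (f v)
  let φ : RightAngledArtinGroup Γ →* Equiv.Perm ℂ := PresentedGroup.toGroup (f := p) (by
    rintro r ⟨v, w, h, rfl⟩
    simp only [map_mul, map_inv, FreeGroup.lift_apply_of]
    rw [mul_inv_eq_one, mul_inv_eq_iff_eq_mul]
    ext x
    simp only [p, Equiv.Perm.mul_apply, affinePerm_apply]
    linear_combination hf v w h)
  have hφ (v : V) : φ (PresentedGroup.of v) = p v := PresentedGroup.toGroup.of _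
  let H : Subgroup (RightAngledArtinGroup Γ) :=
    { carrier := {g | ∀ x, φ g x = χ g * x + φ g 0}
      one_mem' := by simp
      mul_mem' := by
        intro a b (ha : ∀ x, _) (hb : ∀ x, _) x
        rw [map_mul, map_mul, Equiv.Perm.mul_apply, Equiv.Perm.mul_apply, hb, ha, ha (φ b 0),
          Units.val_mul]
        ring
      inv_mem' := by
        intro a (ha : ∀ x, _) x
        apply (φ a).injective
        have h2 : (χ a : ℂ) * χ a⁻¹ = 1 := by simp
        have h3 : φ a (φ a⁻¹ 0) = 0 := by simp
        have h4 : φ a (φ a⁻¹ x) = x := by simp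
        rw [ha] at h3
        rw [h4, ha]
        linear_combination -x * h2 - h3 }
  have hH (g : RightAngledArtinGroup Γ) (x : ℂ) : φ g x = χ g * x + φ g 0 := by
    refine PresentedGroup.generated_by _ H (fun v x => ?_) g x
    simp only [hφ, p, affinePerm_apply]
    simp [raagCharacterEquiv]
  refine ⟨fun g => φ g 0, fun g h => ?_, fun v => ?_⟩
  · simp only [map_mul, Equiv.Perm.mul_apply]
    exact hH g _
  · simp [hφ, p, affinePerm_apply]

theorem mem_image_characteristicVariety_iff (t : V → ℂˣ) :
    t ∈ raagCharacterEquiv Γ '' characteristicVariety (RightAngledArtinGroup Γ) 1 1 ↔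
      ∃ f, IsVertexCocycle Γ t f ∧ ¬ IsVertexPrincipal t f := by
  obtain ⟨χ, rfl⟩ := (raagCharacterEquiv Γ).surjective t
  rw [(raagCharacterEquiv Γ).injective.mem_set_image, mem_characteristicVariety_one_one_iff]
  constructor
  · rintro ⟨z, hz, hn⟩
    exact ⟨_, isVertexCocycle_of_isCrossedHom hz, fun h => hn (principal_of_isVertexPrincipal hz h)⟩
  · rintro ⟨f, hf, hn⟩
    obtain ⟨z, hz, hzf⟩ := exists_isCrossedHom_extending χ hf
    refine ⟨z, hz, fun ⟨c, hc⟩ => hn ⟨c, fun v => ?_⟩⟩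
    rw [← hzf, hc]
    rfl

/-! ### Disconnected full subgraphs and nonprincipal crossed homomorphisms -/

/-- Contrapositively: if every full subgraph containing the support of `t` is connected, then every
vertex cocycle is principal. -/
theorem exists_disconnected_of_not_isVertexPrincipal {t : V → ℂˣ} {f : V → ℂ}
    (hf : IsVertexCocycle Γ t f) (hn : ¬ IsVertexPrincipal t f) :
    ∃ W : Set V, ¬ (Γ.induce W).Connected ∧ t ∈ coordinateSubtorus W := by
  by_contra! hcon
  have key (W : Set V) (hW : ∀ v, t v ≠ 1 → v ∈ W) : (Γ.induce W).Connected := by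
    by_contra h
    exact hcon W h fun v hv => by_contra fun h1 => hv (hW v h1)
  obtain ⟨a, ha⟩ := (key {v | t v ≠ 1} fun _ h => h).nonempty
  have hsub {v : V} (h : t v ≠ 1) : (t v : ℂ) - 1 ≠ 0 := by
    rwa [sub_ne_zero, Ne, Units.val_eq_one]
  refine hn ⟨f a / (t a - 1), fun v => by_contra fun hv => ?_⟩
  set c := f a / ((t a : ℂ) - 1) with hc
  have hac : f a = t a * c - c := by
    rw [hc]
    field_simp [hsub ha]
  -- In the full subgraph on the support and `v`, the equation for `f` spreads from `a` along
  -- walks: each vertex where it holds is not `v`, hence lies in the support.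
  have hconn := key (insert v {v | t v ≠ 1}) fun _ h => Or.inr h
  have hr := hconn.preconnected ⟨a, Or.inr ha⟩ ⟨v, Or.inl rfl⟩
  rw [SimpleGraph.reachable_iff_reflTransGen] at hr
  have hall (x : ↥(insert v {v | t v ≠ 1})) (hx : Relation.ReflTransGen
      (Γ.induce (insert v {v | t v ≠ 1})).Adj ⟨a, Or.inr ha⟩ x) : f x = t x * c - c := by
    induction hx with
    | refl => exact hac
    | @tail x y _ hxy ih =>
      have hx1 : t x ≠ 1 := x.2.resolve_left fun h => hv (h ▸ ih)
      apply mul_left_cancel₀ (hsub hx1)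
      linear_combination hf x y hxy + (t y - 1) * ih
  exact hv (hall _ hr)

/-- A disconnected full subgraph containing the support of `t` carries a nonprincipal vertex
cocycle. -/
theorem exists_not_isVertexPrincipal [Nonempty V] {t : V → ℂˣ} {W : Set V}
    (hW : ¬ (Γ.induce W).Connected) (ht : t ∈ coordinateSubtorus W) :
    ∃ f, IsVertexCocycle Γ t f ∧ ¬ IsVertexPrincipal t f := by
  classical
  by_cases h1 : ∀ v, t v = 1
  · refine ⟨fun _ => 1, fun v w _ => by simp [h1], fun ⟨c, hc⟩ => ?_⟩
    simpa [h1] using hc (Classical.arbitrary V)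
  push Not at h1
  obtain ⟨a, ha⟩ := h1
  have haW : a ∈ W := by_contra fun h => ha (ht a h)
  have hsub {v : V} (h : t v ≠ 1) : (t v : ℂ) - 1 ≠ 0 := by
    rwa [sub_ne_zero, Ne, Units.val_eq_one]
  -- `A` is the connected component of `a` in the full subgraph on `W`.
  let A : Set V := {v | ∃ h : v ∈ W, (Γ.induce W).Reachable ⟨a, haW⟩ ⟨v, h⟩}
  have haA : a ∈ A := ⟨haW, .rfl⟩
  have hA {v w : V} (h : Γ.Adj v w) (hv : v ∈ A) (hw : w ∈ W) : w ∈ A := by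
    obtain ⟨hvW, hr⟩ := hv
    exact ⟨hw, hr.trans (SimpleGraph.Adj.reachable (G := Γ.induce W) (u := ⟨v, hvW⟩)
      (v := ⟨w, hw⟩) h)⟩
  obtain ⟨b, hbW, hbA⟩ : ∃ b ∈ W, b ∉ A := by
    by_contra! h
    exact hW (SimpleGraph.connected_iff_exists_forall_reachable _ |>.2
      ⟨⟨a, haW⟩, fun w => (h w w.2).2⟩)
  by_cases h2 : ∃ b ∉ A, t b ≠ 1
  · obtain ⟨b, hbA, hb⟩ := h2
    refine ⟨fun v => if v ∈ A then t v - 1 else 0, fun v w h => ?_, fun ⟨c, hc⟩ => ?_⟩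
    · have h3 (v w : V) (h : Γ.Adj v w) (hv : v ∈ A) (hw : w ∉ A) : t w = 1 :=
        by_contra fun h1 => hw (hA h hv (by_contra fun h2 => h1 (ht w h2)))
      by_cases hv : v ∈ A <;> by_cases hw : w ∈ A
      · simp only [hv, hw, if_true]; ring
      · simp [hv, hw, h3 v w h hv hw]
      · simp [hv, hw, h3 w v h.symm hw hv]
      · simp [hv, hw]
    · have hca := hc a
      have hcb := hc b
      simp only [haA, hbA, if_true, if_false] at hca hcb
      have hc1 : c = 1 := mul_left_cancel₀ (hsub ha) (by linear_combination -hca)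
      exact hsub hb (by rw [hc1] at hcb; linear_combination -hcb)
  · push Not at h2
    -- No neighbour of `b` is in the support, which is contained in `A`.
    have h3 (w : V) (h : Γ.Adj b w) : t w = 1 :=
      h2 w fun hw => hbA (hA h.symm hw hbW)
    refine ⟨fun v => if v = b then 1 else 0, fun v w h => ?_, fun ⟨c, hc⟩ => ?_⟩
    · by_cases hv : v = b
      · subst hv
        simp [h.ne', h3 w h]
      · by_cases hw : w = b
        · subst hw
          simp [hv, h3 v h.symm]
        · simp [hv, hw]
    · simpa [h2 b hbA] using hc b

theorem exists_nonprincipal_iff [Nonempty V] (t : V → ℂˣ) :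
    (∃ f, IsVertexCocycle Γ t f ∧ ¬ IsVertexPrincipal t f) ↔
      ∃ W : Set V, ¬ (Γ.induce W).Connected ∧ t ∈ coordinateSubtorus W :=
  ⟨fun ⟨_, hf, hn⟩ => exists_disconnected_of_not_isVertexPrincipal hf hn,
    fun ⟨_, hW, ht⟩ => exists_not_isVertexPrincipal hW ht⟩

end RAAG

/-! ### Coordinate subtori in the Zariski topology -/

theorem coordinateSubtorus_subset_iff {V : Type} {W W' : Set V} :
    coordinateSubtorus W ⊆ coordinateSubtorus W' ↔ W ⊆ W' := by
  classical
  refine ⟨fun h v hv => by_contra fun hv' => ?_, fun h t ht v hv => ht v fun hW => hv (h hW)⟩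
  have h1 := h (a := Pi.mulSingle v (-1)) (fun w hw => Pi.mulSingle_eq_of_ne (by grind) _) v hv'
  rw [Pi.mulSingle_eq_same, Units.ext_iff] at h1
  norm_num at h1

theorem isClosed_torusZariski_iff {V : Type} {Z : Set (V → ℂˣ)} :
    @IsClosed _ (torusZariskiTopology V) Z ↔ ∃ F, torusZeroLocus F = Z := by
  rw [← @isOpen_compl_iff _ _ (torusZariskiTopology V)]
  change Zᶜᶜ ∈ Set.range torusZeroLocus ↔ _
  rw [compl_compl, Set.mem_range]

theorem isClosed_coordinateSubtorus {V : Type} (W : Set V) :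
    @IsClosed _ (torusZariskiTopology V) (coordinateSubtorus W) := by
  refine isClosed_torusZariski_iff.2 ⟨(fun v => MvPolynomial.X v - 1) '' Wᶜ, ?_⟩
  ext t
  simp [torusZeroLocus, coordinateSubtorus, sub_eq_zero]

/-- Two polynomials that do not vanish identically on a coordinate subtorus have a common point of
nonvanishing there. -/
theorem exists_mem_coordinateSubtorus_eval_ne_zero {V : Type} [Finite V] (W : Set V)
    {p q : MvPolynomial V ℂ}
    (hp : ∃ t ∈ coordinateSubtorus W, MvPolynomial.eval (fun v => (t v : ℂ)) p ≠ 0)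
    (hq : ∃ t ∈ coordinateSubtorus W, MvPolynomial.eval (fun v => (t v : ℂ)) q ≠ 0) :
    ∃ t ∈ coordinateSubtorus W, MvPolynomial.eval (fun v => (t v : ℂ)) p ≠ 0 ∧
      MvPolynomial.eval (fun v => (t v : ℂ)) q ≠ 0 := by
  classical
  cases nonempty_fintype V
  -- Substitute `1` for the variables outside `W`.
  let s : MvPolynomial V ℂ →ₐ[ℂ] MvPolynomial V ℂ :=
    MvPolynomial.aeval fun v => if v ∈ W then MvPolynomial.X v else 1
  have hs (x : V → ℂ) (r : MvPolynomial V ℂ) : MvPolynomial.eval x (s r) =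
      MvPolynomial.eval (fun v => if v ∈ W then x v else 1) r := by
    rw [← MvPolynomial.coe_aeval_eq_eval, ← MvPolynomial.coe_aeval_eq_eval]
    change ((MvPolynomial.aeval x).comp s) r = MvPolynomial.aeval _ r
    congr 1
    ext v
    by_cases hv : v ∈ W <;> simp [s, hv]
  have hne {r : MvPolynomial V ℂ}
      (hr : ∃ t ∈ coordinateSubtorus W, MvPolynomial.eval (fun v => (t v : ℂ)) r ≠ 0) :
      s r ≠ 0 := by
    obtain ⟨t, ht, hrt⟩ := hr
    intro h0
    have h1 := hs (fun v => (t v : ℂ)) r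
    rw [h0, map_zero] at h1
    refine hrt (Eq.trans ?_ h1.symm)
    congr 2
    funext v
    by_cases hv : v ∈ W <;> simp [hv, ht v]
  -- The product of the variables keeps the point to be found in the torus.
  have hprod : s p * s q * ∏ v : V, MvPolynomial.X v ≠ 0 :=
    mul_ne_zero (mul_ne_zero (hne hp) (hne hq))
      (Finset.prod_ne_zero_iff.2 fun v _ => MvPolynomial.X_ne_zero v)
  obtain ⟨x, hx⟩ : ∃ x, MvPolynomial.eval x (s p * s q * ∏ v : V, MvPolynomial.X v) ≠ 0 := by
    by_contra! h
    exact hprod (MvPolynomial.funext fun x => by rw [h, map_zero])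
  simp only [map_mul, map_prod, MvPolynomial.eval_X, hs, mul_ne_zero_iff,
    Finset.prod_ne_zero_iff, Finset.mem_univ, true_imp_iff] at hx
  obtain ⟨⟨hxp, hxq⟩, hx0⟩ := hx
  have hval : (fun v => (((if v ∈ W then Units.mk0 (x v) (hx0 v) else 1 : ℂˣ)) : ℂ)) =
      fun v => if v ∈ W then x v else 1 := by
    funext v
    by_cases hv : v ∈ W <;> simp [hv]
  refine ⟨fun v => if v ∈ W then Units.mk0 (x v) (hx0 v) else 1, fun v hv => by simp [hv], ?_, ?_⟩
  · rwa [hval]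
  · rwa [hval]

theorem isIrreducible_coordinateSubtorus {V : Type} [Finite V] (W : Set V) :
    @IsIrreducible _ (torusZariskiTopology V) (coordinateSubtorus W) := by
  let := torusZariskiTopology V
  refine ⟨⟨1, fun v _ => rfl⟩, isPreirreducible_iff_isClosed_union_isClosed.2 ?_⟩
  intro Z₁ Z₂ h₁ h₂ hsub
  obtain ⟨F₁, rfl⟩ := isClosed_torusZariski_iff.1 h₁
  obtain ⟨F₂, rfl⟩ := isClosed_torusZariski_iff.1 h₂
  by_contra! hcon
  obtain ⟨hc₁, hc₂⟩ := hcon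
  simp only [Set.not_subset, torusZeroLocus, Set.mem_ofPred_eq, not_forall] at hc₁ hc₂
  obtain ⟨t₁, ht₁, p, hp, hpt⟩ := hc₁
  obtain ⟨t₂, ht₂, q, hq, hqt⟩ := hc₂
  obtain ⟨t, ht, htp, htq⟩ :=
    exists_mem_coordinateSubtorus_eval_ne_zero W ⟨t₁, ht₁, hpt⟩ ⟨t₂, ht₂, hqt⟩
  rcases hsub ht with h | h
  · exact htp (h p hp)
  · exact htq (h q hq)

/-! ### Irreducible components -/

/-- The irreducible components of a union of coordinate subtori indexed by an antichain are
these subtori. -/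
theorem bijOn_torusIrreducibleComponents {V : Type} [Finite V] {𝒲 : Set (Set V)}
    (h𝒲 : IsAntichain (· ⊆ ·) 𝒲) :
    Set.BijOn coordinateSubtorus 𝒲
      (torusIrreducibleComponents (⋃ W ∈ 𝒲, coordinateSubtorus W)) := by
  let := torusZariskiTopology V
  have hcover {Y : Set (V → ℂˣ)} (hY : Y ⊆ ⋃ W ∈ 𝒲, coordinateSubtorus W)
      (hirr : IsIrreducible Y) : ∃ W ∈ 𝒲, Y ⊆ coordinateSubtorus W := by
    have hfin : (coordinateSubtorus '' 𝒲).Finite := 𝒲.toFinite.image _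
    obtain ⟨Z, hZ, hYZ⟩ := isIrreducible_iff_sUnion_isClosed.1 hirr hfin.toFinset
      (by
        intro Z hZ
        obtain ⟨W, -, rfl⟩ := hfin.mem_toFinset.1 hZ
        exact isClosed_coordinateSubtorus W)
      (by rwa [hfin.coe_toFinset, Set.sUnion_image])
    obtain ⟨W, hW, rfl⟩ := hfin.mem_toFinset.1 hZ
    exact ⟨W, hW, hYZ⟩
  have hmem {W : Set V} (hW : W ∈ 𝒲) :
      coordinateSubtorus W ⊆ ⋃ W ∈ 𝒲, coordinateSubtorus W := Set.subset_biUnion_of_mem hW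
  refine ⟨fun W hW => ⟨⟨hmem hW, isIrreducible_coordinateSubtorus W⟩, ?_⟩, ?_, ?_⟩
  · rintro Y ⟨hY, hirr⟩ hWY
    obtain ⟨W', hW', hYW'⟩ := hcover hY hirr
    rwa [h𝒲.eq hW hW' (coordinateSubtorus_subset_iff.1 (hWY.trans hYW'))]
  · intro W _ W' _ h
    exact (coordinateSubtorus_subset_iff.1 h.subset).antisymm
      (coordinateSubtorus_subset_iff.1 h.superset)
  · rintro Z ⟨⟨hZ, hirr⟩, hmax⟩
    obtain ⟨W, hW, hZW⟩ := hcover hZ hirr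
    exact ⟨W, hW, (hmax ⟨hmem hW, isIrreducible_coordinateSubtorus W⟩ hZW).antisymm hZW⟩

theorem proposition8 {V : Type} [Finite V] [Nonempty V] (Γ : SimpleGraph V) :
    raagCharacterEquiv Γ '' characteristicVariety (RightAngledArtinGroup Γ) 1 1 =
        ⋃ W ∈ {W : Set V | IsMaximallyDisconnected Γ W}, coordinateSubtorus W ∧
      Set.BijOn coordinateSubtorus {W : Set V | IsMaximallyDisconnected Γ W}
        (torusIrreducibleComponents
          (raagCharacterEquiv Γ '' characteristicVariety (RightAngledArtinGroup Γ) 1 1)) := by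
  have hunion : raagCharacterEquiv Γ '' characteristicVariety (RightAngledArtinGroup Γ) 1 1 =
      ⋃ W ∈ {W : Set V | IsMaximallyDisconnected Γ W}, coordinateSubtorus W := by
    ext t
    rw [RAAG.mem_image_characteristicVariety_iff, RAAG.exists_nonprincipal_iff, Set.mem_iUnion₂]
    constructor
    · rintro ⟨W, hW, ht⟩
      obtain ⟨W', hle, hmax⟩ :=
        Finite.exists_le_maximal (p := fun U : Set V => ¬ (Γ.induce U).Connected) hW
      exact ⟨W', hmax, coordinateSubtorus_subset_iff.2 hle ht⟩
    · rintro ⟨W, hW : IsMaximallyDisconnected Γ W, ht⟩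
      exact ⟨W, hW.prop, ht⟩
  refine ⟨hunion, ?_⟩
  rw [hunion]
  exact bijOn_torusIrreducibleComponents
    (setOfPred_maximal_antichain fun U : Set V => ¬ (Γ.induce U).Connected)
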